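/- Let $x,y,z$ be independent variables. Consider the initial triple $(x,y,z)$, along with every triple of rational functions in $x,y,z$ (elements of $\mathbb{Q}(x,y,z)$) that can be obtained from the initial triple by a finite sequence of operations of the form $$(X,Y,Z)\mapsto (X',Y,Z),\qquad (X,Y,Z)\mapsto (X,Y',Z),\qquad (X,Y,Z)\mapsto (X,Y,Z'),$$ where $X'=(Y^2+Z^2)/X$, $Y'=(X^2+Z^2)/Y$ and $Z'=(X^2+Y^2)/Z$. Then every rational function that occurs in such a triple is a nonzero Laurent polynomial in $x,y,z$ with positive integer coefficients, that is, a nonempty finite sum $\sum_m c_m\,x^{m_1}y^{m_2}z^{m_3}$ over distinct exponent vectors $m=(m_1,m_2,m_3)\in\mathbb{Z}^3$ with every $c_m$ a positive integer. In particular no operation ever divides by zero. -/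

import Mathlib

namespace Markoff

/-- The field `ℚ(x, y, z)` of rational functions in three variables. -/
abbrev RatFun3 : Type := FractionRing (MvPolynomial (Fin 3) ℚ)

/-- The three variables `x`, `y`, `z` (for `i = 0, 1, 2`), as rational functions. -/
noncomputable def var (i : Fin 3) : RatFun3 :=
  algebraMap (MvPolynomial (Fin 3) ℚ) RatFun3 (MvPolynomial.X i)

/-- The Laurent monomial `x ^ m 0 * y ^ m 1 * z ^ m 2` with integer exponents. -/
noncomputable def laurentMonomial (m : Fin 3 → ℤ) : RatFun3 :=
  ∏ i, var i ^ m i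

/-- `f` is a nonzero Laurent polynomial in `x, y, z` all of whose (nonzero) coefficients are
positive integers: a nonempty finite sum of Laurent monomials with distinct exponent vectors `m`
and coefficients `c m > 0`. -/
def IsPositiveLaurent (f : RatFun3) : Prop :=
  ∃ c : (Fin 3 → ℤ) →₀ ℤ, c ≠ 0 ∧ (∀ m ∈ c.support, 0 < c m) ∧
    f = ∑ m ∈ c.support, (c m : RatFun3) * laurentMonomial m

/-- A single exchange move on triples `(X, Y, Z)` of rational functions. -/
inductive Exchange : RatFun3 × RatFun3 × RatFun3 → RatFun3 × RatFun3 × RatFun3 → Prop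
  | fst (X Y Z : RatFun3) : Exchange (X, Y, Z) ((Y ^ 2 + Z ^ 2) / X, Y, Z)
  | snd (X Y Z : RatFun3) : Exchange (X, Y, Z) (X, (X ^ 2 + Z ^ 2) / Y, Z)
  | trd (X Y Z : RatFun3) : Exchange (X, Y, Z) (X, Y, (X ^ 2 + Y ^ 2) / Z)

/-- The triple `T` is obtained from the initial triple `(x, y, z)` by a (possibly empty) finite
sequence of exchange moves. -/
def Reachable (T : RatFun3 × RatFun3 × RatFun3) : Prop :=
  Relation.ReflTransGen Exchange (var 0, var 1, var 2) T

end Markoff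

/-! Exchanges preserve `K = (x² + y² + z²)/(xyz)`, so each replaces `X` by `K Y Z - X`; the minus
sign hides positivity. Cohn matrices remove it: a triple beyond the seed is, up to order, the upper
right entries of `U`, `UV`, `V`, where `U`, `V` have determinant one and `U`, `V`, `UV` have trace
`K` times that entry. By Cayley–Hamilton, exchanging an outer entry passes to `(U, UV)` or `(UV,
V)`, while exchanging the middle one undoes the last such move (`IsCluster.exchange`). The starting
matrices have Laurent entries with natural number coefficients, and matrix products involve no
subtraction (`CohnTree.mem`). Nonvanishing is separate: every entry is positive at `(1, 1, 1)`
(`Reachable.isPosAtOne`). -/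

namespace Markoff

/-! ### Cohn matrices and Vieta jumping -/

section Matrices

variable {R : Type*} [CommRing R]

/-- The Cayley–Hamilton identity for `2 × 2` matrices of determinant one. -/
theorem mul_self_of_det_eq_one (U : Matrix (Fin 2) (Fin 2) R) (hU : U.det = 1) :
    U * U = U.trace • U - 1 := by
  rw [Matrix.det_fin_two] at hU
  ext i j
  fin_cases i <;> fin_cases j <;>
    simp [Matrix.mul_apply, Fin.sum_univ_two, Matrix.trace_fin_two] <;>
    first | ring1 | linear_combination -hU

theorem mul_mul_of_det_eq_one_left (U V : Matrix (Fin 2) (Fin 2) R) (hU : U.det = 1) :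
    U * (U * V) = U.trace • (U * V) - V := by
  rw [← mul_assoc, mul_self_of_det_eq_one U hU, sub_mul, one_mul, smul_mul_assoc]

theorem mul_mul_of_det_eq_one_right (U V : Matrix (Fin 2) (Fin 2) R) (hV : V.det = 1) :
    (U * V) * V = V.trace • (U * V) - U := by
  rw [mul_assoc, mul_self_of_det_eq_one V hV, mul_sub, mul_one, mul_smul_comm]

/-- Pairs of unimodular matrices whose upper right entries, together with that of their product,
form a solution of `X² + Y² + Z² = K X Y Z`, with traces `K` times these entries. -/
structure IsCohnPair (K : R) (U V : Matrix (Fin 2) (Fin 2) R) : Prop where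
  det_left : U.det = 1
  det_right : V.det = 1
  trace_left : U.trace = K * U 0 1
  trace_right : V.trace = K * V 0 1
  trace_mul : (U * V).trace = K * (U * V) 0 1
  markoff : U 0 1 ^ 2 + (U * V) 0 1 ^ 2 + V 0 1 ^ 2 = K * U 0 1 * (U * V) 0 1 * V 0 1

namespace IsCohnPair

variable {K : R} {U V : Matrix (Fin 2) (Fin 2) R}

theorem apply_mul_left (h : IsCohnPair K U V) :
    (U * (U * V)) 0 1 = K * U 0 1 * (U * V) 0 1 - V 0 1 := by
  rw [mul_mul_of_det_eq_one_left U V h.det_left, h.trace_left]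
  simp only [Matrix.sub_apply, Matrix.smul_apply, smul_eq_mul]

theorem apply_mul_right (h : IsCohnPair K U V) :
    ((U * V) * V) 0 1 = K * V 0 1 * (U * V) 0 1 - U 0 1 := by
  rw [mul_mul_of_det_eq_one_right U V h.det_right, h.trace_right]
  simp only [Matrix.sub_apply, Matrix.smul_apply, smul_eq_mul]

/-- By Cayley–Hamilton, the trace and the upper right entry obey the same linear recurrence, so
their ratio `K` persists. -/
theorem left (h : IsCohnPair K U V) : IsCohnPair K U (U * V) where
  det_left := h.det_left
  det_right := by rw [Matrix.det_mul, h.det_left, h.det_right, one_mul]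
  trace_left := h.trace_left
  trace_right := h.trace_mul
  trace_mul := by
    rw [h.apply_mul_left, mul_mul_of_det_eq_one_left U V h.det_left, Matrix.trace_sub,
      Matrix.trace_smul, h.trace_mul, h.trace_right, h.trace_left, smul_eq_mul]
    ring
  markoff := by
    rw [h.apply_mul_left]
    linear_combination h.markoff

theorem right (h : IsCohnPair K U V) : IsCohnPair K (U * V) V where
  det_left := by rw [Matrix.det_mul, h.det_left, h.det_right, one_mul]
  det_right := h.det_right
  trace_left := h.trace_mul
  trace_right := h.trace_right
  trace_mul := by
    rw [h.apply_mul_right, mul_mul_of_det_eq_one_right U V h.det_right, Matrix.trace_sub,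
      Matrix.trace_smul, h.trace_mul, h.trace_right, h.trace_left, smul_eq_mul]
    ring
  markoff := by
    rw [h.apply_mul_right]
    linear_combination h.markoff

/-- Vieta: the two factors on the left are the roots of the Markoff equation as a quadratic in its
third unknown. -/
theorem mul_apply_mul_left (h : IsCohnPair K U V) :
    (U * (U * V)) 0 1 * V 0 1 = U 0 1 ^ 2 + (U * V) 0 1 ^ 2 := by
  rw [h.apply_mul_left]
  linear_combination -h.markoff

theorem mul_apply_mul_right (h : IsCohnPair K U V) :
    ((U * V) * V) 0 1 * U 0 1 = (U * V) 0 1 ^ 2 + V 0 1 ^ 2 := by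
  rw [h.apply_mul_right]
  linear_combination -h.markoff

end IsCohnPair

end Matrices

/-! ### Seeds, the tree of Cohn pairs, and closure under exchange -/

section Clusters

variable {F : Type*} [Field F]

/-- The left matrix of the pair attached to the triple `(a, (a² + c²) / b, c)`. -/
def leftMatrix (a b c : F) : Matrix (Fin 2) (Fin 2) F :=
  !![c * b⁻¹, a; a * b⁻¹ ^ 2, (a ^ 2 + b ^ 2) * (b⁻¹ * c⁻¹)]

/-- The right matrix of the pair attached to the triple `(a, (a² + c²) / b, c)`. -/
def rightMatrix (a b c : F) : Matrix (Fin 2) (Fin 2) F :=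
  !![(b ^ 2 + c ^ 2) * (a⁻¹ * b⁻¹), c; c * b⁻¹ ^ 2, a * b⁻¹]

/-- Triples of units of the semiring `S` solving the Markoff equation with constant `K`. -/
structure IsSeed (S : Subsemiring F) (K a b c : F) : Prop where
  ne_zero : a ≠ 0 ∧ b ≠ 0 ∧ c ≠ 0
  mem : a ∈ S ∧ b ∈ S ∧ c ∈ S
  inv_mem : a⁻¹ ∈ S ∧ b⁻¹ ∈ S ∧ c⁻¹ ∈ S
  markoff : a ^ 2 + b ^ 2 + c ^ 2 = K * a * b * c

theorem IsSeed.swap_left {S : Subsemiring F} {K a b c : F} (h : IsSeed S K a b c) :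
    IsSeed S K b a c where
  ne_zero := ⟨h.ne_zero.2.1, h.ne_zero.1, h.ne_zero.2.2⟩
  mem := ⟨h.mem.2.1, h.mem.1, h.mem.2.2⟩
  inv_mem := ⟨h.inv_mem.2.1, h.inv_mem.1, h.inv_mem.2.2⟩
  markoff := by linear_combination h.markoff

theorem IsSeed.swap_right {S : Subsemiring F} {K a b c : F} (h : IsSeed S K a b c) :
    IsSeed S K a c b where
  ne_zero := ⟨h.ne_zero.1, h.ne_zero.2.2, h.ne_zero.2.1⟩
  mem := ⟨h.mem.1, h.mem.2.2, h.mem.2.1⟩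
  inv_mem := ⟨h.inv_mem.1, h.inv_mem.2.2, h.inv_mem.2.1⟩
  markoff := by linear_combination h.markoff

theorem leftMatrix_mul_rightMatrix_apply {a b c : F} :
    (leftMatrix a b c * rightMatrix a b c) 0 1 = (a ^ 2 + c ^ 2) / b := by
  simp [leftMatrix, rightMatrix, Matrix.mul_apply, Fin.sum_univ_two]
  ring

theorem IsSeed.isCohnPair {S : Subsemiring F} {K a b c : F} (h : IsSeed S K a b c) :
    IsCohnPair K (leftMatrix a b c) (rightMatrix a b c) := by
  obtain ⟨ha, hb, hc⟩ := h.ne_zero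
  -- Eliminating `K` leaves only rational identities in `a`, `b`, `c`.
  have hK : K = (a ^ 2 + b ^ 2 + c ^ 2) / (a * b * c) := by
    rw [h.markoff]
    field_simp
  subst hK
  constructor
  · simp [leftMatrix, Matrix.det_fin_two]
    field_simp
    ring
  · simp [rightMatrix, Matrix.det_fin_two]
    field_simp
    ring
  · simp [leftMatrix, Matrix.trace_fin_two]
    field_simp
    ring
  · simp [rightMatrix, Matrix.trace_fin_two]
    field_simp
    ring
  · rw [leftMatrix_mul_rightMatrix_apply]
    simp [leftMatrix, rightMatrix, Matrix.trace_fin_two]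
    field_simp
    ring
  · rw [leftMatrix_mul_rightMatrix_apply]
    simp [leftMatrix, rightMatrix]
    field_simp
    ring

theorem IsSeed.leftMatrix_mem {S : Subsemiring F} {K a b c : F} (h : IsSeed S K a b c)
    (i j : Fin 2) : leftMatrix a b c i j ∈ S := by
  obtain ⟨ha, hb, hc⟩ := h.mem
  obtain ⟨-, hb', hc'⟩ := h.inv_mem
  fin_cases i <;> fin_cases j
  · exact mul_mem hc hb'
  · exact ha
  · exact mul_mem ha (pow_mem hb' 2)
  · exact mul_mem (add_mem (pow_mem ha 2) (pow_mem hb 2)) (mul_mem hb' hc')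

theorem IsSeed.rightMatrix_mem {S : Subsemiring F} {K a b c : F} (h : IsSeed S K a b c)
    (i j : Fin 2) : rightMatrix a b c i j ∈ S := by
  obtain ⟨ha, hb, hc⟩ := h.mem
  obtain ⟨ha', hb', -⟩ := h.inv_mem
  fin_cases i <;> fin_cases j
  · exact mul_mem (add_mem (pow_mem hb 2) (pow_mem hc 2)) (mul_mem ha' hb')
  · exact hc
  · exact mul_mem hc (pow_mem hb' 2)
  · exact mul_mem ha hb'

theorem mul_apply_mem {S : Subsemiring F} {U V : Matrix (Fin 2) (Fin 2) F}
    (hU : ∀ i j, U i j ∈ S) (hV : ∀ i j, V i j ∈ S) (i j : Fin 2) : (U * V) i j ∈ S := by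
  rw [Matrix.mul_apply]
  exact sum_mem fun k _ => mul_mem (hU i k) (hV k j)

/-- The pairs of matrices obtained from the pair of a seed by the moves
`(U, V) ↦ (U, UV)` and `(U, V) ↦ (UV, V)`. -/
inductive CohnTree (S : Subsemiring F) (K : F) :
    Matrix (Fin 2) (Fin 2) F → Matrix (Fin 2) (Fin 2) F → Prop
  | seed {a b c : F} (h : IsSeed S K a b c) :
      CohnTree S K (leftMatrix a b c) (rightMatrix a b c)
  | left {U V : Matrix (Fin 2) (Fin 2) F} (h : CohnTree S K U V) : CohnTree S K U (U * V)
  | right {U V : Matrix (Fin 2) (Fin 2) F} (h : CohnTree S K U V) : CohnTree S K (U * V) V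

theorem CohnTree.isCohnPair {S : Subsemiring F} {K : F} {U V : Matrix (Fin 2) (Fin 2) F}
    (h : CohnTree S K U V) : IsCohnPair K U V := by
  induction h with
  | seed h => exact h.isCohnPair
  | left _ ih => exact ih.left
  | right _ ih => exact ih.right

theorem CohnTree.mem {S : Subsemiring F} {K : F} {U V : Matrix (Fin 2) (Fin 2) F}
    (h : CohnTree S K U V) : (∀ i j, U i j ∈ S) ∧ ∀ i j, V i j ∈ S := by
  induction h with
  | seed h => exact ⟨h.leftMatrix_mem, h.rightMatrix_mem⟩
  | left _ ih => exact ⟨ih.1, mul_apply_mem ih.1 ih.2⟩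
  | right _ ih => exact ⟨mul_apply_mem ih.1 ih.2, ih.2⟩

/-- Triples that are, in some order, a seed or the upper right entries of `U`, `UV` and `V` for a
pair `(U, V)` in the tree of Cohn matrices. -/
inductive IsCluster (S : Subsemiring F) (K : F) : F → F → F → Prop
  | seed {a b c : F} (h : IsSeed S K a b c) : IsCluster S K a b c
  | node {U V : Matrix (Fin 2) (Fin 2) F} (h : CohnTree S K U V) :
      IsCluster S K (U 0 1) ((U * V) 0 1) (V 0 1)
  | swap_left {X Y Z : F} (h : IsCluster S K X Y Z) : IsCluster S K Y X Z
  | swap_right {X Y Z : F} (h : IsCluster S K X Y Z) : IsCluster S K X Z Y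

namespace IsCluster

variable {S : Subsemiring F} {K X Y Z : F}

theorem mem (h : IsCluster S K X Y Z) : X ∈ S ∧ Y ∈ S ∧ Z ∈ S := by
  induction h with
  | seed h => exact h.mem
  | node h => exact ⟨h.mem.1 0 1, mul_apply_mem h.mem.1 h.mem.2 0 1, h.mem.2 0 1⟩
  | swap_left _ ih => exact ⟨ih.2.1, ih.1, ih.2.2⟩
  | swap_right _ ih => exact ⟨ih.1, ih.2.2, ih.2.1⟩

theorem of_isSeed {a b c : F} (h : IsSeed S K a b c) : IsCluster S K a ((a ^ 2 + c ^ 2) / b) c := by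
  have := IsCluster.node (CohnTree.seed h)
  rwa [leftMatrix_mul_rightMatrix_apply] at this

/-- Replacing the product entry of a node leads back to its parent. -/
theorem of_cohnTree {U V : Matrix (Fin 2) (Fin 2) F} (h : CohnTree S K U V)
    (h0 : (U * V) 0 1 ≠ 0) :
    IsCluster S K (U 0 1) ((U 0 1 ^ 2 + V 0 1 ^ 2) / (U * V) 0 1) (V 0 1) := by
  cases h with
  | @seed a b c h =>
    rw [leftMatrix_mul_rightMatrix_apply] at h0 ⊢
    have : (leftMatrix a b c 0 1 ^ 2 + rightMatrix a b c 0 1 ^ 2) / ((a ^ 2 + c ^ 2) / b) = b := by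
      have hn : a ^ 2 + c ^ 2 ≠ 0 := fun hn => h0 (by rw [hn, zero_div])
      have hb := h.ne_zero.2.1
      simp only [leftMatrix, rightMatrix, Matrix.of_apply, Matrix.cons_val_zero,
        Matrix.cons_val_one]
      field_simp
    rw [this]
    exact .seed h
  | @left _ V h =>
    rw [← h.isCohnPair.mul_apply_mul_left, mul_div_cancel_left₀ _ h0]
    exact .swap_right (.node h)
  | @right U _ h =>
    rw [← h.isCohnPair.mul_apply_mul_right, mul_div_cancel_left₀ _ h0]
    exact .swap_left (.node h)

theorem exchange (h : IsCluster S K X Y Z) (hX : X ≠ 0) (hY : Y ≠ 0) (hZ : Z ≠ 0) :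
    IsCluster S K ((Y ^ 2 + Z ^ 2) / X) Y Z ∧ IsCluster S K X ((X ^ 2 + Z ^ 2) / Y) Z ∧
      IsCluster S K X Y ((X ^ 2 + Y ^ 2) / Z) := by
  induction h with
  | seed h =>
    -- Each direction out of the seed has its own tree, rooted at a reordering that puts the
    -- exchanged variable in the middle.
    exact ⟨(of_isSeed h.swap_left).swap_left, of_isSeed h, (of_isSeed h.swap_right).swap_right⟩
  | node h =>
    refine ⟨?_, of_cohnTree h hY, ?_⟩
    · rw [← h.isCohnPair.mul_apply_mul_right, mul_div_cancel_right₀ _ hX]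
      exact (node h.right).swap_left
    · rw [← h.isCohnPair.mul_apply_mul_left, mul_div_cancel_right₀ _ hZ]
      exact (node h.left).swap_right
  | @swap_left X Y Z _ ih =>
    obtain ⟨h1, h2, h3⟩ := ih hY hX hZ
    refine ⟨h2.swap_left, h1.swap_left, ?_⟩
    rw [add_comm]
    exact h3.swap_left
  | @swap_right X Y Z _ ih =>
    obtain ⟨h1, h2, h3⟩ := ih hX hZ hY
    refine ⟨?_, h3.swap_right, h2.swap_right⟩
    rw [add_comm]
    exact h1.swap_right

end IsCluster

end Clusters

/-! ### Nonvanishing and positive Laurent polynomials -/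

section Laurent

theorem var_ne_zero (i : Fin 3) : var i ≠ 0 := by
  rw [var, Ne, IsFractionRing.to_map_eq_zero_iff]
  exact MvPolynomial.X_ne_zero i

/-- Quotients of polynomials that take positive values at `(1, 1, 1)`. -/
def IsPosAtOne (f : RatFun3) : Prop :=
  ∃ p q : MvPolynomial (Fin 3) ℚ, 0 < MvPolynomial.eval 1 p ∧ 0 < MvPolynomial.eval 1 q ∧
    f = algebraMap _ RatFun3 p / algebraMap _ RatFun3 q

theorem algebraMap_ne_zero_of_eval_pos {p : MvPolynomial (Fin 3) ℚ}
    (hp : 0 < MvPolynomial.eval 1 p) : algebraMap _ RatFun3 p ≠ 0 := by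
  rw [Ne, IsFractionRing.to_map_eq_zero_iff]
  rintro rfl
  simp at hp

namespace IsPosAtOne

variable {f g : RatFun3}

theorem ne_zero (hf : IsPosAtOne f) : f ≠ 0 := by
  obtain ⟨p, q, hp, hq, rfl⟩ := hf
  exact div_ne_zero (algebraMap_ne_zero_of_eval_pos hp) (algebraMap_ne_zero_of_eval_pos hq)

theorem var (i : Fin 3) : IsPosAtOne (var i) :=
  ⟨MvPolynomial.X i, 1, by simp, by simp, by rw [map_one, div_one]; rfl⟩

theorem add (hf : IsPosAtOne f) (hg : IsPosAtOne g) : IsPosAtOne (f + g) := by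
  obtain ⟨p, q, hp, hq, rfl⟩ := hf
  obtain ⟨r, s, hr, hs, rfl⟩ := hg
  refine ⟨p * s + q * r, q * s, ?_, ?_, ?_⟩
  · rw [map_add, map_mul, map_mul]; positivity
  · rw [map_mul]; positivity
  · rw [map_add, map_mul, map_mul, map_mul]
    exact div_add_div _ _ (algebraMap_ne_zero_of_eval_pos hq) (algebraMap_ne_zero_of_eval_pos hs)

theorem mul (hf : IsPosAtOne f) (hg : IsPosAtOne g) : IsPosAtOne (f * g) := by
  obtain ⟨p, q, hp, hq, rfl⟩ := hf
  obtain ⟨r, s, hr, hs, rfl⟩ := hg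
  refine ⟨p * r, q * s, ?_, ?_, ?_⟩
  · rw [map_mul]; positivity
  · rw [map_mul]; positivity
  · rw [map_mul, map_mul, div_mul_div_comm]

theorem inv (hf : IsPosAtOne f) : IsPosAtOne f⁻¹ := by
  obtain ⟨p, q, hp, hq, rfl⟩ := hf
  exact ⟨q, p, hq, hp, inv_div _ _⟩

theorem exchange {h : RatFun3} (hf : IsPosAtOne f) (hg : IsPosAtOne g) (hh : IsPosAtOne h) :
    IsPosAtOne ((g ^ 2 + h ^ 2) / f) := by
  rw [div_eq_mul_inv, pow_two, pow_two]
  exact ((hg.mul hg).add (hh.mul hh)).mul hf.inv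

end IsPosAtOne

theorem Reachable.isPosAtOne {T : RatFun3 × RatFun3 × RatFun3} (h : Reachable T) :
    IsPosAtOne T.1 ∧ IsPosAtOne T.2.1 ∧ IsPosAtOne T.2.2 := by
  induction h with
  | refl => exact ⟨.var 0, .var 1, .var 2⟩
  | tail _ hstep ih =>
    obtain ⟨h1, h2, h3⟩ := ih
    cases hstep with
    | fst X Y Z => exact ⟨h1.exchange h2 h3, h2, h3⟩
    | snd X Y Z => exact ⟨h1, h2.exchange h1 h3, h3⟩
    | trd X Y Z => exact ⟨h1, h2, h3.exchange h1 h2⟩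

/-- Laurent monomials as a homomorphism from exponent vectors. -/
noncomputable def laurentMonomialHom : Multiplicative (Fin 3 → ℤ) →* RatFun3 where
  toFun m := laurentMonomial m.toAdd
  map_one' := by simp [laurentMonomial]
  map_mul' m n := by
    simp only [laurentMonomial, toAdd_mul, Pi.add_apply]
    rw [← Finset.prod_mul_distrib]
    exact Finset.prod_congr rfl fun i _ => zpow_add₀ (var_ne_zero i) _ _

/-- The semiring of Laurent polynomials with natural number coefficients. -/
noncomputable def natLaurent : Subsemiring RatFun3 :=
  (AddMonoidAlgebra.lift ℕ RatFun3 (Fin 3 → ℤ) laurentMonomialHom).toRingHom.rangeS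

theorem laurentMonomial_mem_natLaurent (m : Fin 3 → ℤ) : laurentMonomial m ∈ natLaurent :=
  ⟨AddMonoidAlgebra.single m 1, by
    simp [laurentMonomialHom]⟩

theorem laurentMonomial_single (i : Fin 3) (k : ℤ) :
    laurentMonomial (Pi.single i k) = var i ^ k := by
  rw [laurentMonomial, Finset.prod_eq_single i]
  · rw [Pi.single_eq_same]
  · intro j _ hj
    rw [Pi.single_eq_of_ne hj, zpow_zero]
  · simp

theorem var_zpow_mem_natLaurent (i : Fin 3) (k : ℤ) : var i ^ k ∈ natLaurent :=
  laurentMonomial_single i k ▸ laurentMonomial_mem_natLaurent _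

theorem isPositiveLaurent_of_mem_natLaurent {f : RatFun3} (hf : f ∈ natLaurent) (h0 : f ≠ 0) :
    IsPositiveLaurent f := by
  obtain ⟨p, rfl⟩ := hf
  -- Natural coefficients on the support are automatically positive; only the cast to `ℤ` must be
  -- seen to lose no term.
  have hsupp : (p.coeff.mapRange (Nat.cast : ℕ → ℤ) Nat.cast_zero).support = p.coeff.support :=
    Finsupp.support_mapRange_of_injective _ _ Nat.cast_injective
  refine ⟨p.coeff.mapRange (Nat.cast : ℕ → ℤ) Nat.cast_zero, ?_, ?_, ?_⟩
  · intro hc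
    rw [hc, Finsupp.support_zero, eq_comm, Finsupp.support_eq_empty,
      AddMonoidAlgebra.coeff_eq_zero] at hsupp
    exact h0 (by rw [hsupp, map_zero])
  · intro m hm
    rw [hsupp, Finsupp.mem_support_iff] at hm
    rw [Finsupp.mapRange_apply]
    exact_mod_cast Nat.pos_of_ne_zero hm
  · rw [hsupp]
    refine (AddMonoidAlgebra.lift_apply' _ p).trans (Finset.sum_congr rfl fun m _ => ?_)
    rw [Finsupp.mapRange_apply, Int.cast_natCast]
    exact congrArg (· * laurentMonomial m) (eq_natCast (algebraMap ℕ RatFun3) (p.coeff m))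

theorem isSeed_var : IsSeed natLaurent
    ((var 0 ^ 2 + var 1 ^ 2 + var 2 ^ 2) / (var 0 * var 1 * var 2)) (var 0) (var 1) (var 2) where
  ne_zero := ⟨var_ne_zero 0, var_ne_zero 1, var_ne_zero 2⟩
  mem := by
    refine ⟨?_, ?_, ?_⟩ <;> rw [← zpow_one (var _)] <;> exact var_zpow_mem_natLaurent _ _
  inv_mem := by
    refine ⟨?_, ?_, ?_⟩ <;> rw [← zpow_neg_one (var _)] <;> exact var_zpow_mem_natLaurent _ _
  markoff := by
    have h := mul_ne_zero (mul_ne_zero (var_ne_zero 0) (var_ne_zero 1)) (var_ne_zero 2)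
    rw [mul_assoc, mul_assoc, ← mul_assoc (var 0), div_mul_cancel₀ _ h]

theorem Reachable.isCluster {T : RatFun3 × RatFun3 × RatFun3} (h : Reachable T) :
    IsCluster natLaurent ((var 0 ^ 2 + var 1 ^ 2 + var 2 ^ 2) / (var 0 * var 1 * var 2))
      T.1 T.2.1 T.2.2 := by
  induction h with
  | refl => exact .seed isSeed_var
  | tail hT hstep ih =>
    obtain ⟨h1, h2, h3⟩ := Reachable.isPosAtOne hT
    have hex := ih.exchange h1.ne_zero h2.ne_zero h3.ne_zero
    cases hstep with
    | fst X Y Z => exact hex.1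
    | snd X Y Z => exact hex.2.1
    | trd X Y Z => exact hex.2.2

end Laurent

end Markoff

theorem theorem5 (X Y Z : Markoff.RatFun3) (h : Markoff.Reachable (X, Y, Z)) :
    Markoff.IsPositiveLaurent X ∧ Markoff.IsPositiveLaurent Y ∧ Markoff.IsPositiveLaurent Z := by
  obtain ⟨hX, hY, hZ⟩ := h.isCluster.mem
  obtain ⟨pX, pY, pZ⟩ := h.isPosAtOne
  exact ⟨Markoff.isPositiveLaurent_of_mem_natLaurent hX pX.ne_zero,
    Markoff.isPositiveLaurent_of_mem_natLaurent hY pY.ne_zero,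
    Markoff.isPositiveLaurent_of_mem_natLaurent hZ pZ.ne_zero⟩
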